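/- **Definitions.** A continuum is a nonempty compact connected metric space. It is unicoherent if, whenever it is the union of two subcontinua $A$ and $B$, the set $A\cap B$ is connected. An arc is a space homeomorphic to $[0,1]$; its end points are the images of $0$ and $1$ under such a homeomorphism. A dendroid is a continuum in which any two distinct points are the end points of an arc and each of whose subcontinua is unicoherent; such an arc is then unique, and $[x,y]$ denotes the arc with end points $x\ne y$, while $[x,x]=\{x\}$. An end point of a dendroid $X$ is a point that is an end point of every arc in $X$ containing it; $E(X)$ is the set of all of them. A ramification point of $X$ is the image of $(0,0)$ under an embedding of $([-1,1]\times\{0\})\cup(\{0\}\times[0,1])$ into $X$. A fan is a dendroid with at most one ramification point, which is called its top if it exists. A fan $X$ with top $v$ is smooth if $x_n\to x$ in $X$ implies $[v,x_n]\to[v,x]$ in the Hausdorff metric. A *Lelek fan* is a smooth fan $X$ (with a top) such that $E(X)$ is dense in $X$. A *Cantor fan* is a space homeomorphic to $\bigcup_{c\in K}A_c\subseteq\mathbb R^2$, where $K\subseteq[0,1]$ is the Cantor middle third set and $A_c$ is the straight line segment from $(\tfrac12,0)$ to $(c,1)$. **Theorem.** Let $L$ be a Lelek fan, let $C\subseteq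 L$ be a subspace that is a Cantor fan, and let $f:L\to L$ be an embedding (a homeomorphism onto its image) such that $f(L)\subseteq C$. Then $f$ does not admit a retraction, i.e. there is no continuous map $r:L\to f(L)$ with $r(y)=y$ for all $y\in f(L)$. -/

import Mathlib

open Set Filter Topology

namespace Fans

/-- A continuum: a nonempty compact connected space (to be used on metric spaces). -/
def IsContinuum (X : Type*) [TopologicalSpace X] : Prop :=
  CompactSpace X ∧ ConnectedSpace X

/-- A subset which, with the subspace topology, is a continuum (`IsConnected` includes
nonemptiness). -/
def IsSubcontinuum {X : Type*} [TopologicalSpace X] (A : Set X) : Prop :=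
  IsCompact A ∧ IsConnected A

/-- A subcontinuum `Y` of `X` is unicoherent: whenever it is the union of two of its subcontinua
`A` and `B`, the set `A ∩ B` is connected. -/
def IsUnicoherent {X : Type*} [TopologicalSpace X] (Y : Set X) : Prop :=
  ∀ A B : Set X, IsSubcontinuum A → IsSubcontinuum B → Y = A ∪ B → IsConnected (A ∩ B)

/-- Every subcontinuum is unicoherent. -/
def IsHereditarilyUnicoherent (X : Type*) [TopologicalSpace X] : Prop :=
  ∀ Y : Set X, IsSubcontinuum Y → IsUnicoherent Y

/-- The subset `A` is an arc, i.e. homeomorphic to `[0,1]`. -/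
def IsArc {X : Type*} [TopologicalSpace X] (A : Set X) : Prop :=
  Nonempty (unitInterval ≃ₜ A)

/-- `x` is an end point of the arc `A`. -/
def IsArcEndPoint {X : Type*} [TopologicalSpace X] (A : Set X) (x : X) : Prop :=
  ∃ φ : unitInterval ≃ₜ A, (φ 0 : X) = x

/-- The subset `A` is an arc with end points `x` and `y`. -/
def IsArcBetween {X : Type*} [TopologicalSpace X] (A : Set X) (x y : X) : Prop :=
  ∃ φ : unitInterval ≃ₜ A, (φ 0 : X) = x ∧ (φ 1 : X) = y

/-- Any two distinct points are the end points of an arc. -/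
def IsArcwiseConnected (X : Type*) [TopologicalSpace X] : Prop :=
  ∀ x y : X, x ≠ y → ∃ A : Set X, IsArcBetween A x y

/-- A dendroid: an arcwise connected, hereditarily unicoherent continuum. -/
def IsDendroid (X : Type*) [TopologicalSpace X] : Prop :=
  IsContinuum X ∧ IsArcwiseConnected X ∧ IsHereditarilyUnicoherent X

/-- The set `E(X)` of the points that are an end point of every arc containing them. -/
def endPoints (X : Type*) [TopologicalSpace X] : Set X :=
  {x | ∀ A : Set X, IsArc A → x ∈ A → IsArcEndPoint A x}

/-- The model of the simple triod, `([-1,1] × {0}) ∪ ({0} × [0,1])`. -/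
def triodModel : Set (ℝ × ℝ) :=
  (Icc (-1) 1 ×ˢ {0}) ∪ ({0} ×ˢ Icc 0 1)

/-- The subset `T` is a simple triod with top `x`. -/
def IsSimpleTriodWithTop {X : Type*} [TopologicalSpace X] (T : Set X) (x : X) : Prop :=
  ∃ φ : triodModel ≃ₜ T, ∃ h : ((0, 0) : ℝ × ℝ) ∈ triodModel, (φ ⟨(0, 0), h⟩ : X) = x

/-- The set `R(X)` of ramification points: the tops of simple triods in `X`. -/
def ramificationPoints (X : Type*) [TopologicalSpace X] : Set X :=
  {x | ∃ T : Set X, IsSimpleTriodWithTop T x}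

/-- A fan: a dendroid with at most one ramification point. -/
def IsFan (X : Type*) [TopologicalSpace X] : Prop :=
  IsDendroid X ∧ (ramificationPoints X).Subsingleton

/-- `A` is the set `[x,y]`: the singleton `{x}` if `x = y`, and otherwise an arc with end points
`x` and `y`. In a dendroid exactly one set `A` has this property, for all `x` and `y`. -/
def IsSegment {X : Type*} [TopologicalSpace X] (A : Set X) (x y : X) : Prop :=
  (x = y ∧ A = {x}) ∨ (x ≠ y ∧ IsArcBetween A x y)

/-- A smooth fan: a fan with a top `v` such that `xₙ → x` implies `[v,xₙ] → [v,x]`, where the sets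
converge in the Hausdorff metric. -/
def IsSmoothFan (X : Type*) [MetricSpace X] : Prop :=
  IsFan X ∧ ∃ v ∈ ramificationPoints X,
    ∀ (x : X) (u : ℕ → X), Tendsto u atTop (𝓝 x) →
      ∀ (S : Set X) (s : ℕ → Set X), IsSegment S v x → (∀ n, IsSegment (s n) v (u n)) →
        Tendsto (fun n => Metric.hausdorffEDist (s n) S) atTop (𝓝 0)

/-- A Lelek fan: a smooth fan whose end points are dense. -/
def IsLelekFan (X : Type*) [MetricSpace X] : Prop :=
  IsSmoothFan X ∧ closure (endPoints X) = univ

/-- The model of the Cantor fan: the union over the points `c` of the Cantor middle third set of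
the straight line segments from `(1/2, 0)` to `(c, 1)` in the plane. -/
def cantorFanModel : Set (ℝ × ℝ) :=
  ⋃ c ∈ cantorSet, segment ℝ ((1 / 2, 0) : ℝ × ℝ) (c, 1)

/-- A Cantor fan: a space homeomorphic to the model. (The model is a fan, so it is not necessary
to ask that `X` be one.) -/
def IsCantorFan (X : Type*) [TopologicalSpace X] : Prop :=
  Nonempty (X ≃ₜ cantorFanModel)

/-- `r` is a retraction from `X` onto its subspace `Y`. -/
def IsRetraction {X : Type*} [TopologicalSpace X] (Y : Set X) (r : X → Y) : Prop :=
  Continuous r ∧ ∀ y : Y, r y = y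

/-- The map `f : X → Y` admits a retraction: there is one from `Y` onto `f(X)`. -/
def AdmitsRetraction {X Y : Type*} [TopologicalSpace Y] (f : X → Y) : Prop :=
  ∃ r : Y → range f, IsRetraction (range f) r

end Fans

namespace Fans

open unitInterval

/-! Restricted to `C`, a retraction onto `f(L)` would give maps `F : L → K` and `ρ : K → L` with `ρ
∘ F = id`, where `K` is the model Cantor fan. Only connectedness, two points and dense end points of
`L` are then needed for a contradiction. The image of `F` contains the top, since otherwise it is an
interval in one leg, where end points are not dense. It is closed downwards along legs: `F ∘ ρ` maps
a leg to a path that can reach a point of it only by climbing that leg. Take a point of the image at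
height `h > 0` on a leg `c`. `F ∘ ρ` fixes the leg below it, hence nearly preserves heights on
nearby legs. An end point `m` with `F m` near the middle of that part lies on a nearby leg `d`;
pushing `d` through `F ∘ ρ` gives a point of the image above `F m` on `d`. So `m` is interior to an
arc, a contradiction. -/

lemma isTotallyDisconnected_cantorSet : IsTotallyDisconnected cantorSet := by
  have : TotallyDisconnectedSpace cantorSet :=
    cantorSetHomeomorphNatToBool.symm.totallyDisconnectedSpace
  exact totallyDisconnectedSpace_subtype_iff.1 this

/-- The point at height `s` on the leg of the Cantor fan that ends at `(c, 1)`. -/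
noncomputable def fanPoint (c : cantorSet) (s : I) : cantorFanModel :=
  ⟨((1 - s) / 2 + s * c, s), by
    refine mem_biUnion c.2 ⟨1 - s, s, by linarith [s.2.2], s.2.1, by ring, ?_⟩
    ext <;> (simp [smul_eq_mul]; try ring)⟩

/-- The height of a point of the Cantor fan above its top. -/
def height (k : cantorFanModel) : ℝ := (k : ℝ × ℝ).2

/-- The label of the leg that contains a point of positive height. -/
noncomputable def leg (k : cantorFanModel) : ℝ :=
  ((k : ℝ × ℝ).1 - (1 - height k) / 2) / height k

lemma exists_eq_fanPoint (k : cantorFanModel) : ∃ c s, k = fanPoint c s := by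
  obtain ⟨k, hk⟩ := k
  simp only [cantorFanModel, mem_iUnion] at hk
  obtain ⟨c, hc, a, b, ha, hb, hab, rfl⟩ := hk
  refine ⟨⟨c, hc⟩, ⟨b, hb, by linarith⟩, Subtype.ext ?_⟩
  obtain rfl : a = 1 - b := by linarith
  ext <;> (simp [fanPoint, smul_eq_mul]; try ring)

@[simp] lemma height_fanPoint (c : cantorSet) (s : I) : height (fanPoint c s) = s := rfl

lemma height_nonneg (k : cantorFanModel) : 0 ≤ height k := by
  obtain ⟨c, s, rfl⟩ := exists_eq_fanPoint k
  exact s.2.1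

lemma leg_fanPoint (c : cantorSet) {s : I} (hs : (0 : ℝ) < s) : leg (fanPoint c s) = c := by
  simp only [leg, height_fanPoint]
  simp only [fanPoint]
  field_simp
  ring

/-- Height and leg are coordinates away from the top only; at the top `leg` is a junk `0 / 0`, hence
the assumption `0 < s`. -/
lemma fanPoint_eq {c : cantorSet} {s : I} {k : cantorFanModel} (hs : (0 : ℝ) < s)
    (h : height k = s) (hl : leg k = c) : fanPoint c s = k := by
  obtain ⟨c', s', rfl⟩ := exists_eq_fanPoint k
  obtain rfl : s' = s := Subtype.ext h
  rw [leg_fanPoint c' hs] at hl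
  rw [Subtype.ext hl]

lemma fanPoint_zero (c : cantorSet) {k : cantorFanModel} (hk : height k = 0) :
    fanPoint c 0 = k := by
  obtain ⟨c', s', rfl⟩ := exists_eq_fanPoint k
  obtain rfl : s' = 0 := Subtype.ext hk
  simp [fanPoint]

lemma continuous_fanPoint : Continuous fun x : cantorSet × I => fanPoint x.1 x.2 := by
  unfold fanPoint
  fun_prop

lemma continuous_height : Continuous height := by
  unfold height
  fun_prop

lemma continuousAt_leg {k : cantorFanModel} (hk : 0 < height k) : ContinuousAt leg k := by
  have := continuous_height.continuousAt (x := k)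
  unfold leg
  exact ContinuousAt.div (by fun_prop) this hk.ne'

lemma leg_mem {k : cantorFanModel} (hk : 0 < height k) : leg k ∈ cantorSet := by
  obtain ⟨c, s, rfl⟩ := exists_eq_fanPoint k
  rw [leg_fanPoint c hk]
  exact c.2

/-- A connected set that does not contain the top lies in a single leg. -/
lemma leg_eq_of_isPreconnected {S : Set cantorFanModel} (hS : IsPreconnected S)
    (hpos : ∀ k ∈ S, 0 < height k) {x y : cantorFanModel} (hx : x ∈ S) (hy : y ∈ S) :
    leg x = leg y := by
  have hc : ContinuousOn leg S := fun k hk => (continuousAt_leg (hpos k hk)).continuousWithinAt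
  refine isTotallyDisconnected_cantorSet _ ?_ (hS.image _ hc) (mem_image_of_mem _ hx)
    (mem_image_of_mem _ hy)
  rintro _ ⟨k, hk, rfl⟩
  exact leg_mem (hpos k hk)

/-- A path that climbs to a point of a leg from a height of at most `s` passes through the point
of that leg at height `s`. -/
lemma exists_height_eq_of_path {u : I → cantorFanModel} (hu : Continuous u) (b : I) {s : ℝ}
    (hs : 0 < s) (h0 : height (u 0) ≤ s) (hb : s ≤ height (u b)) :
    ∃ x, height (u x) = s ∧ leg (u x) = leg (u b) := by
  have hhu : Continuous fun x => height (u x) := continuous_height.comp hu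
  have hcomp : IsCompact (Icc 0 b ∩ {x | height (u x) ≤ s}) :=
    isCompact_Icc.inter_right (isClosed_le hhu continuous_const)
  -- The last time before `b` at height at most `s`; afterwards the path avoids the top, so it
  -- cannot change legs.
  obtain ⟨t, ⟨ht, hts⟩, hmax⟩ := hcomp.exists_isGreatest ⟨0, ⟨le_rfl, b.2.1⟩, h0⟩
  obtain ⟨x, hx, hxs⟩ := intermediate_value_Icc ht.2 hhu.continuousOn ⟨hts, hb⟩
  have hxt : x ≤ t := hmax ⟨⟨ht.1.trans hx.1, hx.2⟩, hxs.le⟩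
  obtain rfl : x = t := le_antisymm hxt hx.1
  refine ⟨x, hxs, leg_eq_of_isPreconnected (S := u '' Icc x b)
    (isPreconnected_Icc.image _ hu.continuousOn) ?_ (mem_image_of_mem _ ⟨le_rfl, ht.2⟩)
    (mem_image_of_mem _ ⟨ht.2, le_rfl⟩)⟩
  rintro _ ⟨y, hy, rfl⟩
  by_contra hneg
  have hyx : y ≤ x := hmax ⟨⟨ht.1.trans hy.1, hy.2⟩, (not_lt.1 hneg).trans hs.le⟩
  obtain rfl : y = x := le_antisymm hyx hy.1
  exact hneg (hs.trans_eq hxs.symm)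

/-- A self-homeomorphism of the unit interval maps `0` to one of the two ends. -/
lemma homeomorph_unitInterval_apply_zero (θ : I ≃ₜ I) : θ 0 = 0 ∨ θ 0 = 1 := by
  by_contra! h
  -- Deleting `0` leaves a connected set, while deleting an interior point would separate `0` from
  -- `1`.
  have hpre : IsPreconnected (θ '' Ioc 0 1) := isPreconnected_Ioc.image _ θ.continuous.continuousOn
  have hmem : ∀ y, θ 0 ≠ y → y ∈ θ '' Ioc 0 1 := fun y hy =>
    ⟨θ.symm y, ⟨lt_of_le_of_ne nonneg' fun h0 => hy (by rw [h0, θ.apply_symm_apply]), le_one'⟩,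
      θ.apply_symm_apply y⟩
  obtain ⟨x, hx, hx0⟩ := hpre.ordConnected.out (hmem 0 h.1) (hmem 1 h.2)
    (⟨nonneg', le_one'⟩ : θ 0 ∈ Icc 0 1)
  exact hx.1.ne' (θ.injective hx0)

/-- An end point is not an interior point of an injective path. -/
lemma eq_zero_or_one_of_mem_endPoints {L : Type*} [TopologicalSpace L] [T2Space L] {γ : I → L}
    (hγ : Continuous γ) (hinj : Function.Injective γ) {x : I} (hx : γ x ∈ endPoints L) :
    x = 0 ∨ x = 1 := by
  let φ : I ≃ₜ range γ := (hγ.isClosedEmbedding hinj).isEmbedding.toHomeomorph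
  obtain ⟨ψ, hψ⟩ := hx (range γ) ⟨φ⟩ (mem_range_self x)
  have h0 : (ψ.trans φ.symm) 0 = x := by
    rw [Homeomorph.trans_apply, Homeomorph.symm_apply_eq]
    exact Subtype.ext hψ
  exact h0 ▸ homeomorph_unitInterval_apply_zero (ψ.trans φ.symm)

/-! ### Retracts of the Cantor fan -/

section Retract

variable {L : Type*} [TopologicalSpace L] {F : L → cantorFanModel}
  {ρ : cantorFanModel → L}

/-- An end point of a retract of the Cantor fan is not between two points of the retract on a
leg. -/
lemma not_mem_endPoints_of_between [T2Space L] (hρ : Continuous ρ) (hρF : Function.LeftInverse ρ F)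
    {m : L} {c : cantorSet} {a b s : I} (has : a < s) (hsb : s < b) (hm : F m = fanPoint c s)
    (hseg : ∀ x ∈ Icc a b, fanPoint c x ∈ range F) : m ∉ endPoints L := by
  intro hE
  have hab : (a : ℝ) < b := has.trans hsb
  have hbds : ∀ x : I, a + (b - a) * (x : ℝ) ∈ Icc (a : ℝ) b := fun x =>
    ⟨by nlinarith [x.2.1], by nlinarith [x.2.2]⟩
  -- Affine reparametrization of `[a, b]`; `ρ` is injective on that part of the leg, as `F` undoes
  -- it there.
  let e : I → I := fun x =>
    ⟨a + (b - a) * x, a.2.1.trans (hbds x).1, (hbds x).2.trans b.2.2⟩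
  have he : Continuous e := by fun_prop
  have hFρ : ∀ x, F (ρ (fanPoint c (e x))) = fanPoint c (e x) := fun x => by
    obtain ⟨l, hl⟩ := hseg (e x) (hbds x)
    rw [← hl, hρF l]
  have hinj : Function.Injective fun x => ρ (fanPoint c (e x)) := fun x y hxy => by
    have h1 := congrArg (fun l => height (F l)) hxy
    simp only [hFρ, height_fanPoint, e] at h1
    exact Subtype.ext (mul_left_cancel₀ (sub_pos.2 hab).ne' (add_left_cancel h1))
  have hcont : Continuous fun x => ρ (fanPoint c (e x)) :=
    hρ.comp (continuous_fanPoint.comp (continuous_const.prodMk he))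
  have has' : (a : ℝ) < s := has
  have hsb' : (s : ℝ) < b := hsb
  let x : I := ⟨(s - a) / (b - a), div_nonneg (by linarith) (by linarith),
    (div_le_one (by linarith)).2 (by linarith)⟩
  have hex : e x = s := Subtype.ext <| by
    have : (b : ℝ) - a ≠ 0 := (sub_pos.2 hab).ne'
    simp only [e, x]
    field_simp
    ring
  have hx : ρ (fanPoint c (e x)) = m := by rw [hex, ← hm, hρF]
  rcases eq_zero_or_one_of_mem_endPoints hcont hinj (x := x) (hx ▸ hE) with h | h
  · rw [h] at hex
    exact has'.ne (by simpa [e] using congrArg Subtype.val hex)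
  · rw [h] at hex
    exact hsb'.ne' (by simpa [e] using congrArg Subtype.val hex)

/-- If a retract of the Cantor fan contains the top, then it contains the part of a leg below each
of its points. -/
lemma fanPoint_mem_range_of_le (hF : Continuous F) (hρ : Continuous ρ)
    (hρF : Function.LeftInverse ρ F) {t : L} (ht : height (F t) = 0) {c : cantorSet} {x s : I}
    (hxs : x ≤ s) (hs : fanPoint c s ∈ range F) : fanPoint c x ∈ range F := by
  have hfix : ∀ k ∈ range F, F (ρ k) = k := by
    rintro _ ⟨l, rfl⟩
    rw [hρF]
  have h0 : fanPoint c 0 = F t := fanPoint_zero c ht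
  rcases eq_or_lt_of_le (x.2.1 : (0 : ℝ) ≤ x) with hx | hx
  · obtain rfl : x = 0 := Subtype.ext hx.symm
    exact ⟨t, h0.symm⟩
  have hu : Continuous fun y => F (ρ (fanPoint c y)) :=
    hF.comp (hρ.comp (continuous_fanPoint.comp (continuous_const.prodMk continuous_id)))
  obtain ⟨y, hy, hl⟩ := exists_height_eq_of_path hu s hx
    (by simp only [h0, hρF t, ht]; exact hx.le)
    (by simp only [hfix _ hs, height_fanPoint]; exact hxs)
  simp only [hfix _ hs] at hl
  rw [leg_fanPoint c (hx.trans_le hxs)] at hl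
  rw [fanPoint_eq hx hy hl]
  exact mem_range_self _

/-- A connected retract of the Cantor fan that has at least two points and dense end points
contains the top. -/
lemma exists_height_eq_zero [T2Space L] [ConnectedSpace L] [Nontrivial L] (hE : Dense (endPoints L))
    (hF : Continuous F) (hρ : Continuous ρ) (hρF : Function.LeftInverse ρ F) :
    ∃ t, height (F t) = 0 := by
  by_contra! htop
  have hpos : ∀ l, 0 < height (F l) := fun l => lt_of_le_of_ne (height_nonneg _) (htop l).symm
  have hleg : ∀ l l', leg (F l) = leg (F l') := fun l l' =>
    leg_eq_of_isPreconnected (isPreconnected_range hF)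
      (by rintro _ ⟨l, rfl⟩; exact hpos l) (mem_range_self l) (mem_range_self l')
  have hhF : Continuous fun l => height (F l) := continuous_height.comp hF
  have hord : OrdConnected (range fun l => height (F l)) :=
    (isPreconnected_range hhF).ordConnected
  obtain ⟨c, hc⟩ : ∃ c : cantorSet, ∀ l, leg (F l) = c :=
    ⟨⟨_, leg_mem (hpos (Classical.arbitrary L))⟩, fun l => hleg l _⟩
  have hform : ∀ l, ∃ s : I, (s : ℝ) = height (F l) ∧ F l = fanPoint c s := fun l => by
    obtain ⟨c', s, h⟩ := exists_eq_fanPoint (F l)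
    have hs : height (F l) = s := by rw [h, height_fanPoint]
    exact ⟨s, hs.symm, (fanPoint_eq (hs ▸ hpos l) hs (hc l)).symm⟩
  obtain ⟨l₁, l₂, hlt⟩ : ∃ l₁ l₂, height (F l₁) < height (F l₂) := by
    obtain ⟨l₁, l₂, hne⟩ := exists_pair_ne L
    have : height (F l₁) ≠ height (F l₂) := fun h => by
      obtain ⟨s₁, h₁, e₁⟩ := hform l₁
      obtain ⟨s₂, h₂, e₂⟩ := hform l₂
      obtain rfl : s₁ = s₂ := Subtype.ext (by rw [h₁, h₂, h])
      exact hne (hρF.injective (e₁.trans e₂.symm))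
    rcases this.lt_or_gt with h | h
    exacts [⟨_, _, h⟩, ⟨_, _, h⟩]
  obtain ⟨p, hp⟩ := hord.out (mem_range_self l₁) (mem_range_self l₂)
    (⟨by linarith, by linarith⟩ :
      (height (F l₁) + height (F l₂)) / 2 ∈ Icc (height (F l₁)) (height (F l₂)))
  have hopen : IsOpen {l | height (F l) ∈ Ioo (height (F l₁)) (height (F l₂))} :=
    isOpen_Ioo.preimage hhF
  obtain ⟨m, hm, hmE⟩ := hE.inter_open_nonempty _ hopen
    ⟨p, by simp only [mem_ofPred_eq, hp, mem_Ioo]; constructor <;> linarith⟩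
  obtain ⟨a, ha, -⟩ := hform l₁
  obtain ⟨b, hb, -⟩ := hform l₂
  obtain ⟨s, hs, hms⟩ := hform m
  refine not_mem_endPoints_of_between hρ hρF (a := a) (b := b) (s := s) ?_ ?_ hms ?_ hmE
  · exact Subtype.coe_lt_coe.1 (by rw [ha, hs]; exact hm.1)
  · exact Subtype.coe_lt_coe.1 (by rw [hb, hs]; exact hm.2)
  · intro x hx
    obtain ⟨l, hl⟩ := hord.out (mem_range_self l₁) (mem_range_self l₂)
      (⟨ha ▸ hx.1, hb ▸ hx.2⟩ : (x : ℝ) ∈ Icc (height (F l₁)) (height (F l₂)))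
    exact ⟨l, (fanPoint_eq (hl ▸ hpos l) hl (hc l)).symm⟩

/-- A connected space that has at least two points and dense end points is not a retract of the
Cantor fan. -/
theorem not_leftInverse_of_dense_endPoints [T2Space L] [ConnectedSpace L] [Nontrivial L]
    (hE : Dense (endPoints L)) (hF : Continuous F) (hρ : Continuous ρ) :
    ¬ Function.LeftInverse ρ F := by
  intro hρF
  obtain ⟨t, ht⟩ := exists_height_eq_zero hE hF hρ hρF
  have hfix : ∀ k ∈ range F, F (ρ k) = k := by
    rintro _ ⟨l, rfl⟩
    rw [hρF]
  obtain ⟨q, hqt⟩ := exists_ne t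
  obtain ⟨c, h, hq⟩ := exists_eq_fanPoint (F q)
  have hh : (0 : ℝ) < h := by
    refine lt_of_le_of_ne h.2.1 fun h0 => hqt (hρF.injective ?_)
    obtain rfl : h = 0 := Subtype.ext h0.symm
    rw [hq, fanPoint_zero c ht]
  have hseg : ∀ s ≤ h, fanPoint c s ∈ range F := fun s hs =>
    fanPoint_mem_range_of_le hF hρ hρF ht hs ⟨q, hq⟩
  let G : cantorSet × I → cantorFanModel := fun x => F (ρ (fanPoint x.1 x.2))
  have hG : Continuous G := hF.comp (hρ.comp continuous_fanPoint)
  -- Tube lemma: `F ∘ ρ` is the identity on the leg `c` up to height `h`, so it moves heights little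
  -- on all nearby legs.
  have htube : ∀ᶠ c' in 𝓝 c, ∀ s ∈ Icc 0 h, |height (G (c', s)) - s| < h / 8 := by
    refine isCompact_Icc.eventually_forall_of_forall_eventually fun s hs => ?_
    have hcont : Continuous fun x : cantorSet × I => |height (G x) - x.2| := by
      have := continuous_height.comp hG
      fun_prop
    refine hcont.continuousAt.eventually_lt continuousAt_const ?_
    simp only [G, hfix _ (hseg s hs.2), height_fanPoint, sub_self, abs_zero]
    positivity
  rw [nhds_subtype_eq_comap, eventually_comap] at htube
  let s₀ : I := ⟨h / 2, by linarith, by linarith [h.2.2]⟩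
  have hp := hfix _ (hseg s₀ (Subtype.coe_le_coe.1 (by simp only [s₀]; linarith)))
  set p := ρ (fanPoint c s₀)
  have hs₀ : (0 : ℝ) < s₀ := by simp only [s₀]; linarith
  have hlegp : Tendsto (fun l => leg (F l)) (𝓝 p) (𝓝 c) := by
    have : ContinuousAt leg (F p) := continuousAt_leg (by rw [hp]; exact hs₀)
    have := this.comp hF.continuousAt
    rwa [ContinuousAt, Function.comp_apply, hp, leg_fanPoint c hs₀] at this
  have hhp : ∀ᶠ l in 𝓝 p, |height (F l) - h / 2| < h / 8 := by
    have hcont : Continuous fun l => |height (F l) - h / 2| := by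
      have := continuous_height.comp hF
      fun_prop
    refine hcont.continuousAt.eventually_lt continuousAt_const ?_
    simp only [hp, height_fanPoint, s₀, sub_self, abs_zero]
    positivity
  -- The height of `F m` is between `3h/8` and `5h/8`. With error `h/8`, the path below stays above
  -- height `h/4` and ends above `7h/8`, higher than `F m`.
  obtain ⟨m, hmE, hm, hmh⟩ :=
    ((mem_closure_iff_frequently.1 (hE p)).and_eventually
      ((hlegp.eventually htube).and hhp)).exists
  obtain ⟨d, s, hms⟩ := exists_eq_fanPoint (F m)
  rw [hms, height_fanPoint, abs_lt] at hmh
  have hs : (0 : ℝ) < s := by linarith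
  have hsh : (s : ℝ) ≤ h := by linarith
  have hd := hm d (by rw [hms, leg_fanPoint d hs])
  have hGpos : ∀ x ∈ Icc s h, 0 < height (G (d, x)) := fun x hx => by
    have := (abs_lt.1 (hd x ⟨nonneg', hx.2⟩)).1
    have hsx : (s : ℝ) ≤ x := hx.1
    linarith
  -- This path starts at `F m` and misses the top, so its other end is on the leg `d` too.
  have hpre : IsPreconnected ((fun x => G (d, x)) '' Icc s h) :=
    isPreconnected_Icc.image _ (hG.comp (continuous_const.prodMk continuous_id)).continuousOn
  have hGs : G (d, s) = fanPoint d s := hfix _ ⟨m, hms⟩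
  have hlegG : leg (G (d, h)) = d := by
    rw [← leg_fanPoint d hs, ← hGs]
    refine leg_eq_of_isPreconnected hpre ?_ (mem_image_of_mem _ ⟨hsh, le_rfl⟩)
      (mem_image_of_mem _ ⟨le_rfl, hsh⟩)
    rintro _ ⟨x, hx, rfl⟩
    exact hGpos x hx
  obtain ⟨d', b, hb⟩ := exists_eq_fanPoint (G (d, h))
  have hbh : (s : ℝ) < b := by
    have := (abs_lt.1 (hd h ⟨nonneg', le_rfl⟩)).1
    rw [hb, height_fanPoint] at this
    linarith
  rw [hb, leg_fanPoint d' (hs.trans hbh)] at hlegG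
  obtain rfl : d' = d := Subtype.ext hlegG
  exact not_mem_endPoints_of_between hρ hρF (a := 0) (b := b) (s := s) hs hbh hms
    (fun x hx => fanPoint_mem_range_of_le hF hρ hρF ht hx.2 ⟨_, hb⟩) hmE

end Retract

lemma IsSmoothFan.nontrivial {X : Type*} [MetricSpace X] (hX : IsSmoothFan X) : Nontrivial X := by
  obtain ⟨-, v, ⟨T, φ, -⟩, -⟩ := hX
  have h₀ : ((0, 0) : ℝ × ℝ) ∈ triodModel := by simp [triodModel]
  have h₁ : ((1, 0) : ℝ × ℝ) ∈ triodModel := by simp [triodModel]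
  refine ⟨φ ⟨_, h₀⟩, φ ⟨_, h₁⟩, fun h => ?_⟩
  simpa using φ.injective (Subtype.ext h)

end Fans

theorem theorem4p3 {L : Type*} [MetricSpace L] (hL : Fans.IsLelekFan L)
    (C : Set L) (hC : Fans.IsCantorFan C)
    (f : L → L) (hf : IsEmbedding f) (hfC : range f ⊆ C) :
    ¬ Fans.AdmitsRetraction f := by
  rintro ⟨r, hr, hrf⟩
  obtain ⟨g⟩ := hC
  have := hL.1.1.1.1.2
  have := hL.1.nontrivial
  refine Fans.not_leftInverse_of_dense_endPoints (dense_iff_closure_eq.2 hL.2)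
    (F := fun x => g ⟨f x, hfC (mem_range_self x)⟩)
    (ρ := fun k => hf.toHomeomorph.symm (r (g.symm k))) ?_ ?_ fun x => ?_
  · have := hf.continuous
    fun_prop
  · have := hf.toHomeomorph.symm.continuous
    fun_prop
  · simp only [Homeomorph.symm_apply_apply, hrf ⟨f x, mem_range_self x⟩]
    exact hf.toHomeomorph.symm_apply_apply x
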